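/- All fields have characteristic $0$. For a difference field $(F,\sigma)$ (a field $F$ with an automorphism $\sigma$) put $\Delta(f)=\sigma(f)-f$ and let $C=\{c : \sigma(c)=c\}$ be its field of constants. A complete reduction for a $C$-subspace $U$ of a $C$-vector space $V$ is a $C$-linear map $\phi:V\to V$ with $f-\phi(f)\in U$ for all $f\in V$ and $\ker\phi=U$. Let $F_0\le F_1\le\dots\le F_n$ be a $\Sigma^*$-tower over $(F_0,\sigma)$: $F_i=F_{i-1}(t_i)$ with $t_i$ transcendental over $F_{i-1}$, $\sigma(t_i)=t_i+a_i$ with $a_i\in F_{i-1}$, and $(F_n,\sigma)$ has the same field of constants $C$ as $(F_0,\sigma)$. For $f\in F_n$ let $\operatorname{ind}_n(f)=\min\{0\le i\le n : f\in F_i\}$. Let $M_i$ be the set of monic irreducible polynomials in $F_{i-1}[t_i]$. Let $\Theta_0$ be a $C$-basis of $F_0$, and for $1\le i\le n$ let $\Theta_i=\{t_i^k : k\ge 0\}\cup\{t_i^k/q^j : q\in M_i,\ 0\le k<\deg q,\ j\ge 1\}$ be the canonical $F_{i-1}$-basis of $F_i$. Then $\Xi_i=\{\theta_0\theta_1\cdots\theta_i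 : \theta_j\in\Theta_j\}$ is a $C$-basis of $F_i$; for $\theta\in\Xi_i$ let $\theta^*:F_i\to C$ be the $C$-linear map giving the coefficient of $\theta$ in this basis. Let $\phi_0$ be a complete reduction for $\Delta(F_0)$ on $F_0$. For $i=1,\dots,n$ in turn, suppose that the following choices are made: - $S_i\subseteq M_i$ is a set of representatives of the classes of the relation "$p=c\,\sigma^{\ell}(q)$ for some $c\in F_{i-1}\setminus\{0\}$, $\ell\in\mathbb Z$" on $M_i$, and $U_i$ is the set of all fractions $b/d\in F_i$ with $b,d\in F_{i-1}[t_i]$, $\deg b<\deg d$, and $d$ a finite product of elements of $S_i$; - $\theta_i\in\Xi_{i-1}$ satisfies $\theta_i^*(\phi_{i-1}(\Delta(t_i)))\neq 0$ and $\operatorname{ind}_n(\theta_i)=\operatorname{ind}_n(\phi_{i-1}(\Delta(t_i)))$, and $V_i=\bigoplus_{k\ge 0}(\operatorname{im}\phi_{i-1}\cap\ker\theta_i^*)\,t_i^k$; - $\phi_i$ is the complete reduction for $\Delta(F_i)$ on $F_i$ with image $U_i\oplus V_i$, i.e. the projection onto $U_i\oplus V_i$ along $\Delta(F_i)$ for the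 decomposition $F_i=\Delta(F_i)\oplus U_i\oplus V_i$. Then for every $f\in F_n$, $$\operatorname{ind}_n(\phi_n(f))\le\operatorname{ind}_n(f).$$ -/

import Mathlib

open Polynomial

namespace SigmaStar

section Basic

variable {E : Type*} [Field E]

/-- The field of constants `{c ∈ E | σ c = c}` of the difference field `(E, σ)`. -/
def constField (σ : E ≃+* E) : Subfield E :=
  RingHom.eqLocusField (σ : E →+* E) (RingHom.id E)

theorem mem_constField {σ : E ≃+* E} {c : E} : c ∈ constField σ ↔ σ c = c := Iff.rfl

/-- The forward difference `Δ f = σ f - f`, linear over the constants. -/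
def delta (σ : E ≃+* E) : E →ₗ[constField σ] E where
  toFun f := σ f - f
  map_add' f g := by rw [map_add]; ring
  map_smul' c f := by
    have hc : σ (c : E) = c := c.2
    simp only [Subfield.smul_def, smul_eq_mul, map_mul, hc, RingHom.id_apply]
    ring

/-- The summable space `Δ(F) = {σ g - g | g ∈ F}` of a field `F` between the constants and `E`,
as a subspace of `F` (for `F` closed under `σ` it is the whole image of `F` under `Δ`). -/
def summableSpace (σ : E ≃+* E) (F : IntermediateField (constField σ) E) :
    Submodule (constField σ) F :=
  (F.toSubalgebra.toSubmodule.map (delta σ)).comap F.val.toLinearMap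

theorem mem_summableSpace {σ : E ≃+* E} {F : IntermediateField (constField σ) E} {f : F} :
    f ∈ summableSpace σ F ↔ ∃ g : F, σ (g : E) - g = f := by
  constructor
  · rintro ⟨g, hg, h⟩
    exact ⟨⟨g, hg⟩, h⟩
  · rintro ⟨g, h⟩
    exact ⟨g, g.2, h⟩

end Basic

/-- A linear operator `φ` on `V` is a complete reduction for the subspace `U` if
`f - φ f ∈ U` for all `f` and the kernel of `φ` is `U`. -/
def IsCompleteReduction {C V : Type*} [Field C] [AddCommGroup V] [Module C V]
    (U : Submodule C V) (φ : V →ₗ[C] V) : Prop :=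
  (∀ f, f - φ f ∈ U) ∧ LinearMap.ker φ = U

section Tower

variable {E : Type*} [Field E]

/-- `F 0 ≤ F 1 ≤ ⋯ ≤ F n = E` is a `Σ*`-tower over the difference field `(F 0, σ)`:
`F (i+1) = F i (t i)` with `t i` transcendental over `F i` and `σ (t i) = t i + a i`, `a i ∈ F i`.
That `E` and `F 0` have the same constants is the fact that `F 0` is an intermediate field of
`E` over the constant field of `(E, σ)`. -/
structure IsSigmaTower (σ : E ≃+* E) {n : ℕ}
    (F : Fin (n + 1) → IntermediateField (constField σ) E)
    (t : Fin n → E) (a : ∀ i : Fin n, F i.castSucc) : Prop where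
  base_stable : ∀ x, σ x ∈ F 0 ↔ x ∈ F 0
  top : F (Fin.last n) = ⊤
  adjoin : ∀ i : Fin n, F i.succ =
    (IntermediateField.adjoin (F i.castSucc) {t i}).restrictScalars (constField σ)
  transcendental : ∀ i : Fin n, Transcendental (F i.castSucc) (t i)
  shift : ∀ i : Fin n, σ (t i) = t i + a i

/-- The indicator `min {0 ≤ i ≤ n | f ∈ F i}`. -/
noncomputable def ind {C : Type*} [Field C] [Algebra C E] {n : ℕ}
    (F : Fin (n + 1) → IntermediateField C E) (f : E) : ℕ :=
  sInf {k : ℕ | ∃ i : Fin (n + 1), (i : ℕ) = k ∧ f ∈ F i}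

variable {C : Type*} [Field C] [Algebra C E]

/-- The set `M_t` of monic irreducible polynomials over `F`. -/
def monicIrreducibles (F : IntermediateField C E) : Set F[X] :=
  {q | q.Monic ∧ Irreducible q}

/-- The canonical `F`-basis of `F(t)`: the powers `t ^ k`, and the fractions `t ^ k / q ^ j` with
`q` monic irreducible, `k < deg q` and `j ≥ 1`. -/
def canonicalBasis (F : IntermediateField C E) (t : E) : Set E :=
  {x | ∃ k : ℕ, x = t ^ k} ∪
  {x | ∃ q ∈ monicIrreducibles F, ∃ k j : ℕ,
    k < q.natDegree ∧ 1 ≤ j ∧ x = t ^ k / (aeval t q) ^ j}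

/-- The canonical `C`-basis of `F i` obtained from a `C`-basis `Θ₀` of `F 0`: all products
`θ₀ θ₁ ⋯ θᵢ` with `θ₀ ∈ Θ₀` and `θⱼ` in the canonical basis of the `j`-th extension. -/
def towerBasis {n : ℕ} (F : Fin (n + 1) → IntermediateField C E) (t : Fin n → E) (Θ₀ : Set E)
    (i : Fin (n + 1)) : Set E :=
  Fin.induction (motive := fun _ => Set E) Θ₀
    (fun j Ξ => {x | ∃ ξ ∈ Ξ, ∃ θ ∈ canonicalBasis (F j.castSucc) (t j), x = ξ * θ}) i

/-- `Θ ⊆ E` is a `C`-basis of `F`. -/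
def IsBasisOf (Θ : Set E) (F : IntermediateField C E) : Prop :=
  LinearIndepOn C id Θ ∧ Submodule.span C Θ = F.toSubalgebra.toSubmodule

/-- `θs` is the `C`-linear map `θ* : F → C` of the element `θ` of the basis `Ξ` of `F`:
it is `1` at `θ` and `0` at all other elements of `Ξ`. -/
def IsDualMap {F : IntermediateField C E} (Ξ : Set E) (θ : F) (θs : F →ₗ[C] C) : Prop :=
  θs θ = 1 ∧ ∀ ξ : F, (ξ : E) ∈ Ξ → ξ ≠ θ → θs ξ = 0

/-- `σ`-equivalence of `p, q ∈ F[t]`: `p = c σ^ℓ(q)` for some `c ∈ F`, `c ≠ 0`, and `ℓ ∈ ℤ`. -/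
def SigmaEquiv (σ : RingAut E) (F : IntermediateField C E) (t : E) (p q : F[X]) : Prop :=
  ∃ c : F, c ≠ 0 ∧ ∃ l : ℤ, aeval t p = (c : E) * (σ ^ l) (aeval t q)

/-- `S` is a set of representatives of the classes of `σ`-equivalence on `M_t`. -/
def IsRepresentatives (σ : RingAut E) (F : IntermediateField C E) (t : E) (S : Set F[X]) : Prop :=
  S ⊆ monicIrreducibles F ∧
    ∀ q ∈ monicIrreducibles F, ∃! p, p ∈ S ∧ SigmaEquiv σ F t p q

/-- The space `U_S` of `t`-proper fractions whose denominator is a product of elements of `S`. -/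
def properComplement (F : IntermediateField C E) (t : E) (S : Set F[X]) : Set E :=
  {x | ∃ p d : F[X], d ∈ Submonoid.closure S ∧ p.degree < d.degree ∧
    x = aeval t p / aeval t d}

/-- The `θ`-complement `V_θ = ⨁ i, (im φ ∩ ker θ*) t ^ i` of `Δ(F[t])` in `F[t]`. -/
def polyComplement (F : IntermediateField C E) (t : E) (φ : F →ₗ[C] F) (θs : F →ₗ[C] C) : Set E :=
  {x | ∃ p : F[X], (∀ i, p.coeff i ∈ LinearMap.range φ ⊓ LinearMap.ker θs) ∧ x = aeval t p}

end Tower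

/-- The tower `φ 0, …, φ n` of complete reductions on a `Σ*`-tower that is built from the complete
reduction `φ 0`, the `C`-basis `Θ₀` of `F 0`, sets of representatives `S i`, and basis elements
`θ i` of `F i` (with dual maps `θs i`) that are effective for `φ i (Δ (t i))` and have the same
indicator: `φ (i+1)` is the complete reduction for `Δ(F (i+1))` with image `U_S + V_θ`. -/
structure IsReductionTower {E : Type*} [Field E] (σ : E ≃+* E) {n : ℕ}
    (F : Fin (n + 1) → IntermediateField (constField σ) E)
    (t : Fin n → E) (a : ∀ i : Fin n, F i.castSucc) (Θ₀ : Set E)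
    (φ : ∀ i : Fin (n + 1), F i →ₗ[constField σ] F i)
    (S : ∀ i : Fin n, Set (F i.castSucc)[X])
    (θ : ∀ i : Fin n, F i.castSucc)
    (θs : ∀ i : Fin n, F i.castSucc →ₗ[constField σ] constField σ) : Prop where
  complete : ∀ i, IsCompleteReduction (summableSpace σ (F i)) (φ i)
  representatives : ∀ i : Fin n, IsRepresentatives σ (F i.castSucc) (t i) (S i)
  mem_basis : ∀ i : Fin n, (θ i : E) ∈ towerBasis F t Θ₀ i.castSucc
  dual : ∀ i : Fin n, IsDualMap (towerBasis F t Θ₀ i.castSucc) (θ i) (θs i)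
  effective : ∀ i : Fin n, θs i (φ i.castSucc (a i)) ≠ 0
  ind_eq : ∀ i : Fin n, ind F (θ i : E) = ind F (φ i.castSucc (a i) : E)
  image : ∀ i : Fin n, ∀ x : E, (∃ f : F i.succ, (φ i.succ f : E) = x) ↔
    ∃ u ∈ properComplement (F i.castSucc) (t i) (S i),
      ∃ v ∈ polyComplement (F i.castSucc) (t i) (φ i.castSucc) (θs i), x = u + v

end SigmaStar

namespace SigmaStar

/-! ### Partial fractions, tower bases and indicators. -/

section Tower

variable {E : Type*} [Field E] {C : Type*} [Field C] [Algebra C E]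

/-! It suffices that each `φ i` maps `F i ∩ F j` into `F j` (`apply_mem`), by induction on `i`. By
`apply_succ`, on `F i` the map `φ (i+1)` is `φ i f - c • φ i (a i)`, where `c` is proportional to
the `θ i`-coefficient of `φ i f`. For `f ∈ F j` with `j ≤ i`, only `φ i (a i) ∉ F j` could do harm.
Then `θ i ∉ F j`, as both have the same indicator, while `φ i f ∈ F j` expands in the basis of `F
j`, a part of the basis of `F i` that omits `θ i`; so `c = 0`. That the tower bases span is what
makes this expansion possible; it rests on partial fractions. -/

theorem aeval_div_pow_mem_span_canonicalBasis {F : IntermediateField C E} {t : E} {g r : F[X]}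
    (hg : g ∈ monicIrreducibles F) (hr : r.degree < g.degree) {j : ℕ} (hj : 1 ≤ j) :
    aeval t r / aeval t g ^ j ∈ Submodule.span F (canonicalBasis F t) := by
  rw [aeval_eq_sum_range, Finset.sum_div]
  refine Submodule.sum_mem _ fun k hk => ?_
  rw [smul_div_assoc]
  rcases eq_or_ne r 0 with rfl | hr0
  · simp
  refine Submodule.smul_mem _ _ (Submodule.subset_span (Or.inr ⟨g, hg, k, j, ?_, hj, rfl⟩))
  have := natDegree_lt_natDegree hr0 hr
  rw [Finset.mem_range] at hk
  omega

theorem aeval_mem_span_canonicalBasis {F : IntermediateField C E} {t : E} (p : F[X]) :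
    aeval t p ∈ Submodule.span F (canonicalBasis F t) := by
  rw [aeval_eq_sum_range]
  exact Submodule.sum_mem _ fun k _ =>
    Submodule.smul_mem _ _ (Submodule.subset_span (Or.inl ⟨k, rfl⟩))

/-- Partial fraction decomposition: the canonical basis spans `F(t)`. -/
theorem aeval_div_mem_span_canonicalBasis {F : IntermediateField C E} {t : E}
    (ht : Transcendental F t) (p q : F[X]) :
    aeval t p / aeval t q ∈ Submodule.span F (canonicalBasis F t) := by
  have hne : ∀ {s : F[X]}, s ≠ 0 → aeval t s ≠ 0 := fun hs h =>
    hs ((transcendental_iff.1 ht) _ h)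
  induction q using UniqueFactorizationMonoid.induction_on_coprime generalizing p with
  | h0 => simp
  | h1 hu =>
    obtain ⟨c, hc, rfl⟩ := Polynomial.isUnit_iff.1 hu
    rw [aeval_C, div_eq_inv_mul, ← map_inv₀, ← Algebra.smul_def]
    exact Submodule.smul_mem _ _ (aeval_mem_span_canonicalBasis p)
  | hpr k hπ =>
    rename_i π
    rcases k.eq_zero_or_pos with rfl | hk
    · simpa using aeval_mem_span_canonicalBasis p
    have hπ0 : π ≠ 0 := hπ.ne_zero
    have hl : π.leadingCoeff ≠ 0 := leadingCoeff_ne_zero.2 hπ0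
    set g : F[X] := π * Polynomial.C π.leadingCoeff⁻¹ with hgdef
    have hgm : g.Monic := monic_mul_leadingCoeff_inv hπ0
    have hgi : Irreducible g := (associated_mul_unit_right π _ (Polynomial.isUnit_C.2
      (inv_ne_zero hl).isUnit)).irreducible hπ.irreducible
    have hag : aeval t g ≠ 0 := hne hgm.ne_zero
    have hπg : aeval t π = π.leadingCoeff • aeval t g := by
      rw [hgdef, map_mul, aeval_C, mul_comm, ← Algebra.smul_def, smul_smul,
        mul_inv_cancel₀ hl, one_smul]
    -- The `g`-adic expansion: digits `r i` with `i < k`, so division by `g ^ k` leaves exponents `k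
    -- - i ≥ 1`.
    obtain ⟨Q, r, hr, hp⟩ := eq_quo_mul_pow_add_sum_rem_mul_pow p hgm k
    have key : aeval t p / aeval t (π ^ k) = (π.leadingCoeff ^ k)⁻¹ •
        (aeval t Q + ∑ i, aeval t (r i) / aeval t g ^ (k - i.1)) := by
      rw [map_pow, hπg, _root_.smul_pow, Algebra.smul_def, Algebra.smul_def, map_inv₀, div_mul_eq_div_div_swap,
        div_eq_inv_mul (_ / _)]
      congr 1
      rw [hp, map_add, map_mul, map_pow, map_sum, add_div, mul_div_cancel_right₀ _ (pow_ne_zero _ hag),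
        Finset.sum_div]
      congr 1
      refine Finset.sum_congr rfl fun i _ => ?_
      rw [map_mul, map_pow, div_eq_div_iff (pow_ne_zero _ hag) (pow_ne_zero _ hag), mul_assoc,
        ← pow_add, Nat.add_sub_cancel' i.2.le]
    rw [key]
    refine Submodule.smul_mem _ _ (Submodule.add_mem _ (aeval_mem_span_canonicalBasis Q)
      (Submodule.sum_mem _ fun i _ => ?_))
    exact aeval_div_pow_mem_span_canonicalBasis ⟨hgm, hgi⟩ (hr i) (by omega)
  | hcp hxy hx hy =>
    rename_i x y
    rcases eq_or_ne x 0 with rfl | hx0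
    · simp
    rcases eq_or_ne y 0 with rfl | hy0
    · simp
    -- Bézout's identity `u x + v y = 1` splits the fraction over `x y`.
    obtain ⟨u, v, huv⟩ := hxy.isCoprime
    have key : aeval t p / aeval t (x * y) =
        aeval t (p * v) / aeval t x + aeval t (p * u) / aeval t y := by
      have h1 : aeval t u * aeval t x + aeval t v * aeval t y = 1 := by
        rw [← map_mul, ← map_mul, ← map_add, huv, map_one]
      have hx' := hne hx0
      have hy' := hne hy0
      rw [map_mul, map_mul, map_mul]
      field_simp
      linear_combination (-aeval t p) * h1
    rw [key]
    exact Submodule.add_mem _ (hx _) (hy _)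

theorem one_mem_canonicalBasis (F : IntermediateField C E) (t : E) : 1 ∈ canonicalBasis F t :=
  Or.inl ⟨0, (pow_zero t).symm⟩

theorem towerBasis_succ {n : ℕ} (F : Fin (n + 1) → IntermediateField C E) (t : Fin n → E)
    (Θ₀ : Set E) (i : Fin n) :
    towerBasis F t Θ₀ i.succ = {x | ∃ ξ ∈ towerBasis F t Θ₀ i.castSucc,
      ∃ θ ∈ canonicalBasis (F i.castSucc) (t i), x = ξ * θ} := rfl

theorem towerBasis_monotone {n : ℕ} (F : Fin (n + 1) → IntermediateField C E) (t : Fin n → E)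
    (Θ₀ : Set E) : Monotone (towerBasis F t Θ₀) := by
  refine Fin.monotone_iff_le_succ.2 fun i x hx => ?_
  rw [towerBasis_succ]
  exact ⟨x, hx, 1, one_mem_canonicalBasis _ _, (mul_one x).symm⟩

/-- The factor `y` absorbs the `F`-scalars of `x`, and is then itself expanded over `A`. -/
theorem mul_mem_span_mul {A B : Set E} {F : IntermediateField C E} {x y : E}
    (hF : ∀ z ∈ F, z ∈ Submodule.span C A) (hx : x ∈ Submodule.span F B)
    (hy : y ∈ F) : y * x ∈ Submodule.span C {z | ∃ α ∈ A, ∃ β ∈ B, z = α * β} := by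
  induction hx using Submodule.span_induction generalizing y with
  | zero => simp
  | add u v _ _ hu hv => rw [mul_add]; exact Submodule.add_mem _ (hu hy) (hv hy)
  | smul c u _ hu =>
    rw [Algebra.smul_def, ← mul_assoc]
    exact hu (mul_mem hy c.2)
  | mem b hb =>
    have hy' := hF y hy
    clear hy
    induction hy' using Submodule.span_induction with
    | zero => simp
    | add u v _ _ hu hv => rw [add_mul]; exact Submodule.add_mem _ hu hv
    | smul c u _ hu => rw [smul_mul_assoc]; exact Submodule.smul_mem _ _ hu
    | mem α hα => exact Submodule.subset_span ⟨α, hα, b, hb, rfl⟩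

theorem mem_iff_ind_le {n : ℕ} {F : Fin (n + 1) → IntermediateField C E} (hF : Monotone F)
    (htop : F (Fin.last n) = ⊤) (x : E) (j : Fin (n + 1)) : x ∈ F j ↔ ind F x ≤ j := by
  refine ⟨fun h => Nat.sInf_le ⟨j, rfl, h⟩, fun h => ?_⟩
  obtain ⟨i, hi, hx⟩ := Nat.sInf_mem (s := {k : ℕ | ∃ i : Fin (n + 1), (i : ℕ) = k ∧ x ∈ F i})
    ⟨n, Fin.last n, rfl, htop ▸ IntermediateField.mem_top⟩
  exact hF (Fin.le_def.2 (hi.trans_le h)) hx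

theorem ind_le_ind {n : ℕ} {F : Fin (n + 1) → IntermediateField C E}
    (htop : F (Fin.last n) = ⊤) {x y : E} (h : ∀ j, x ∈ F j → y ∈ F j) :
    ind F y ≤ ind F x := by
  obtain ⟨i, hi, hx⟩ := Nat.sInf_mem (s := {k : ℕ | ∃ i : Fin (n + 1), (i : ℕ) = k ∧ x ∈ F i})
    ⟨n, Fin.last n, rfl, htop ▸ IntermediateField.mem_top⟩
  exact Nat.sInf_le ⟨i, hi, h i hx⟩

end Tower

/-! ### Complete reductions along the tower. -/

section Reduction

variable {E : Type*} [Field E] {σ : E ≃+* E} {n : ℕ}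
  {F : Fin (n + 1) → IntermediateField (constField σ) E} {t : Fin n → E}
  {a : ∀ i : Fin n, F i.castSucc}

theorem IsSigmaTower.monotone (hF : IsSigmaTower σ F t a) : Monotone F := by
  refine Fin.monotone_iff_le_succ.2 fun i x hx => ?_
  rw [hF.adjoin i, IntermediateField.mem_restrictScalars]
  exact IntermediateField.algebraMap_mem _ (⟨x, hx⟩ : F i.castSucc)

theorem IsSigmaTower.gen_mem (hF : IsSigmaTower σ F t a) (i : Fin n) : t i ∈ F i.succ := by
  rw [hF.adjoin i, IntermediateField.mem_restrictScalars]
  exact IntermediateField.mem_adjoin_simple_self _ _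

theorem IsSigmaTower.mem_span_towerBasis (hF : IsSigmaTower σ F t a) {Θ₀ : Set E}
    (hΘ₀ : IsBasisOf Θ₀ (F 0)) (i : Fin (n + 1)) :
    ∀ x ∈ F i, x ∈ Submodule.span (constField σ) (towerBasis F t Θ₀ i) := by
  induction i using Fin.induction with
  | zero =>
    intro x hx
    change x ∈ Submodule.span (constField σ) Θ₀
    rw [hΘ₀.2]
    exact hx
  | succ i ih =>
    intro x hx
    rw [hF.adjoin i, IntermediateField.mem_restrictScalars,
      IntermediateField.mem_adjoin_simple_iff] at hx
    obtain ⟨r, s, rfl⟩ := hx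
    rw [towerBasis_succ, ← one_mul (_ / _)]
    exact mul_mem_span_mul ih (aeval_div_mem_span_canonicalBasis (hF.transcendental i) r s)
      (one_mem _)

theorem IsDualMap.apply_eq_zero {K : IntermediateField (constField σ) E} {Ξ A : Set E} {θ : K}
    {θs : K →ₗ[constField σ] constField σ} (hd : IsDualMap Ξ θ θs) (hA : A ⊆ Ξ) (hAK : A ⊆ K)
    (hθ : (θ : E) ∉ A) {x : K} (hx : (x : E) ∈ Submodule.span (constField σ) A) : θs x = 0 := by
  -- The span lives in `E` but `θs` on `K`, so the proof of `y ∈ K` stays quantified during the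
  -- induction.
  have : ∀ y ∈ Submodule.span (constField σ) A, ∀ hy : y ∈ K, θs ⟨y, hy⟩ = 0 := by
    intro y hy
    induction hy using Submodule.span_induction with
    | mem y hyA =>
      intro hy
      refine hd.2 _ (hA hyA) fun h => hθ ?_
      rw [← h]
      exact hyA
    | zero => exact fun hy => map_zero θs
    | add u v hu hv ihu ihv =>
      have hle : Submodule.span (constField σ) A ≤ K.toSubalgebra.toSubmodule :=
        Submodule.span_le.2 hAK
      intro hy
      have := map_add θs ⟨u, hle hu⟩ ⟨v, hle hv⟩
      rw [ihu, ihv, add_zero] at this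
      exact this
    | smul c u hu ihu =>
      have hle : Submodule.span (constField σ) A ≤ K.toSubalgebra.toSubmodule :=
        Submodule.span_le.2 hAK
      intro hy
      have := map_smul θs c ⟨u, hle hu⟩
      rw [ihu, smul_zero] at this
      exact this
  exact this x hx x.2

theorem IsSigmaTower.towerBasis_subset (hF : IsSigmaTower σ F t a) {Θ₀ : Set E}
    (hΘ₀ : IsBasisOf Θ₀ (F 0)) (i : Fin (n + 1)) : towerBasis F t Θ₀ i ⊆ F i := by
  induction i using Fin.induction with
  | zero =>
    intro x hx
    have : x ∈ Submodule.span (constField σ) Θ₀ := Submodule.subset_span hx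
    rw [hΘ₀.2] at this
    exact this
  | succ i ih =>
    have hle : F i.castSucc ≤ F i.succ := hF.monotone (Fin.castSucc_lt_succ).le
    have hp : ∀ p : (F i.castSucc)[X], aeval (t i) p ∈ F i.succ := fun p => by
      rw [aeval_eq_sum_range]
      exact sum_mem fun k _ => mul_mem (hle (p.coeff k).2) (pow_mem (hF.gen_mem i) k)
    rw [towerBasis_succ]
    rintro _ ⟨ξ, hξ, θ, hθ, rfl⟩
    refine mul_mem (hle (ih hξ)) ?_
    rcases hθ with ⟨k, rfl⟩ | ⟨q, -, k, j, -, -, rfl⟩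
    · exact pow_mem (hF.gen_mem i) k
    · exact div_mem (pow_mem (hF.gen_mem i) k) (pow_mem (hp q) j)

theorem IsCompleteReduction.apply_apply {K V : Type*} [Field K] [AddCommGroup V] [Module K V]
    {U : Submodule K V} {φ : V →ₗ[K] V} (h : IsCompleteReduction U φ) (f : V) :
    φ (φ f) = φ f := by
  have := h.1 f
  rw [← h.2, LinearMap.mem_ker, map_sub, sub_eq_zero] at this
  exact this.symm

theorem IsCompleteReduction.apply_eq_of_sub_mem {K V : Type*} [Field K] [AddCommGroup V]
    [Module K V] {U : Submodule K V} {φ : V →ₗ[K] V} (h : IsCompleteReduction U φ) {f g : V}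
    (hfg : f - g ∈ U) : φ f = φ g := by
  rwa [← h.2, LinearMap.mem_ker, map_sub, sub_eq_zero] at hfg

variable {Θ₀ : Set E} {φ : ∀ i : Fin (n + 1), F i →ₗ[constField σ] F i}
  {S : ∀ i : Fin n, Set (F i.castSucc)[X]} {θ : ∀ i : Fin n, F i.castSucc}
  {θs : ∀ i : Fin n, F i.castSucc →ₗ[constField σ] constField σ}

/-- Such a `v` is a constant polynomial in `V_θ`, hence in the image of `φ (i+1)`, which is
idempotent. -/
theorem IsReductionTower.apply_of_mem_inf
    (hφ : IsReductionTower σ F t a Θ₀ φ S θ θs) (i : Fin n) {v : F i.castSucc}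
    (hv : v ∈ LinearMap.range (φ i.castSucc) ⊓ LinearMap.ker (θs i)) {f : F i.succ}
    (hf : (f : E) = v) : φ i.succ f = f := by
  have h0 : ((0 : E)) ∈ properComplement (F i.castSucc) (t i) (S i) :=
    ⟨0, 1, one_mem _, by simp, by simp⟩
  have h1 : (f : E) ∈ polyComplement (F i.castSucc) (t i) (φ i.castSucc) (θs i) := by
    refine ⟨Polynomial.C v, fun k => ?_, ?_⟩
    · rw [coeff_C]
      split_ifs
      · exact hv
      · exact zero_mem _
    · rw [aeval_C, hf]
      rfl
  obtain ⟨g, hg⟩ := (hφ.image i f).2 ⟨0, h0, f, h1, (zero_add _).symm⟩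
  rw [← Subtype.ext hg]
  exact (hφ.complete i.succ).apply_apply g

/-- On `F i`, the reduction `φ (i+1)` differs from `φ i` by a multiple of `φ i (a i)`. -/
theorem IsReductionTower.apply_succ (hF : IsSigmaTower σ F t a)
    (hφ : IsReductionTower σ F t a Θ₀ φ S θ θs) (i : Fin n) (f : F i.succ) (f' : F i.castSucc)
    (hf : (f : E) = f') :
    (φ i.succ f : E) = (φ i.castSucc f' -
      (θs i (φ i.castSucc f') / θs i (φ i.castSucc (a i))) • φ i.castSucc (a i) :
        F i.castSucc) := by
  have hle : F i.castSucc ≤ F i.succ := hF.monotone (Fin.castSucc_lt_succ).le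
  -- This `c` is chosen to cancel the `θ i`-coefficient, so that `v` lies in `ker θ*`.
  set c := θs i (φ i.castSucc f') / θs i (φ i.castSucc (a i)) with hc
  set v := φ i.castSucc f' - c • φ i.castSucc (a i) with hvdef
  have hv : v ∈ LinearMap.range (φ i.castSucc) ⊓ LinearMap.ker (θs i) := by
    refine ⟨⟨f' - c • a i, by rw [map_sub, map_smul]⟩, ?_⟩
    rw [SetLike.mem_coe, LinearMap.mem_ker, hvdef, map_sub, map_smul, smul_eq_mul, hc,
      div_mul_cancel₀ _ (hφ.effective i), sub_self]
  obtain ⟨g₁, hg₁⟩ := mem_summableSpace.1 ((hφ.complete i.castSucc).1 f')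
  obtain ⟨g₂, hg₂⟩ := mem_summableSpace.1 ((hφ.complete i.castSucc).1 (a i))
  have hmem : f - ⟨v, hle v.2⟩ ∈ summableSpace σ (F i.succ) := by
    -- `Δ (t i - g₂) = φ i (a i)`: the new generator makes this remainder summable in `F (i+1)`.
    refine mem_summableSpace.2 ⟨⟨g₁, hle g₁.2⟩ + c • (⟨t i, hF.gen_mem i⟩ - ⟨g₂, hle g₂.2⟩), ?_⟩
    have hσc : σ (c : E) = c := c.2
    have e₁ : σ (g₁ : E) - g₁ = f' - φ i.castSucc f' := hg₁
    have e₂ : σ (g₂ : E) - g₂ = a i - φ i.castSucc (a i) := hg₂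
    change σ ((g₁ : E) + c * (t i - g₂)) - (g₁ + c * (t i - g₂)) =
      f - (φ i.castSucc f' - c * φ i.castSucc (a i))
    rw [map_add, map_mul, map_sub, hσc, hF.shift i, hf]
    linear_combination e₁ - (c : E) * e₂
  rw [(hφ.complete i.succ).apply_eq_of_sub_mem hmem, hφ.apply_of_mem_inf i hv rfl]

theorem IsReductionTower.apply_mem (hF : IsSigmaTower σ F t a) (hΘ₀ : IsBasisOf Θ₀ (F 0))
    (hφ : IsReductionTower σ F t a Θ₀ φ S θ θs) (i : Fin (n + 1)) :
    ∀ (f : F i) (j : Fin (n + 1)), (f : E) ∈ F j → (φ i f : E) ∈ F j := by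
  induction i using Fin.induction with
  | zero => exact fun f j _ => hF.monotone (Fin.zero_le j) (φ 0 f).2
  | succ i ih =>
    intro f j hfj
    rcases le_or_gt i.succ j with hij | hij
    · exact hF.monotone hij (φ i.succ f).2
    have hji : j ≤ i.castSucc := Fin.le_castSucc_iff.2 hij
    have hfi := hF.monotone hji hfj
    have hφf := ih ⟨f, hfi⟩ j hfj
    rw [hφ.apply_succ hF i f ⟨f, hfi⟩ rfl]
    by_cases ha : (φ i.castSucc (a i) : E) ∈ F j
    · exact sub_mem hφf ((F j).smul_mem ha)
    -- Here the choice of `θ i` with the indicator of `φ i (a i)` enters.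
    · have hθ : (θ i : E) ∉ F j := by
        rwa [mem_iff_ind_le hF.monotone hF.top, hφ.ind_eq i,
          ← mem_iff_ind_le hF.monotone hF.top]
      have hz : θs i (φ i.castSucc ⟨f, hfi⟩) = 0 :=
        (hφ.dual i).apply_eq_zero (towerBasis_monotone F t Θ₀ hji)
          ((hF.towerBasis_subset hΘ₀ j).trans (hF.monotone hji))
          (fun h => hθ (hF.towerBasis_subset hΘ₀ j h)) (hF.mem_span_towerBasis hΘ₀ j _ hφf)
      rw [hz, zero_div, zero_smul, sub_zero]
      exact hφf

end Reduction

end SigmaStar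

theorem mainTheorem9 {E : Type*} [Field E] [CharZero E] (σ : E ≃+* E) {n : ℕ}
    (F : Fin (n + 1) → IntermediateField (SigmaStar.constField σ) E)
    (t : Fin n → E) (a : ∀ i : Fin n, F i.castSucc)
    (hF : SigmaStar.IsSigmaTower σ F t a)
    (Θ₀ : Set E) (hΘ₀ : SigmaStar.IsBasisOf Θ₀ (F 0))
    (φ : ∀ i : Fin (n + 1), F i →ₗ[SigmaStar.constField σ] F i)
    (S : ∀ i : Fin n, Set (Polynomial (F i.castSucc)))
    (θ : ∀ i : Fin n, F i.castSucc)
    (θs : ∀ i : Fin n, F i.castSucc →ₗ[SigmaStar.constField σ] SigmaStar.constField σ)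
    (hφ : SigmaStar.IsReductionTower σ F t a Θ₀ φ S θ θs)
    (f : F (Fin.last n)) :
    SigmaStar.ind F (φ (Fin.last n) f : E) ≤ SigmaStar.ind F (f : E) := by
  exact SigmaStar.ind_le_ind hF.top (hφ.apply_mem hF hΘ₀ (Fin.last n) f)
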